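/- Let $\mathcal E$ be an elementary topos, with terminal object $1$. An object $A$ of $\mathcal E$ is \emph{decidable} if its diagonal $A\to A\times A$ is a complemented subobject, i.e. $A\times A\cong A+U$ for some $U$, with the diagonal as first injection. Suppose that $\mathcal E$ satisfies the following two postulates. (NS) Every non-initial object $X$ has a point $1\to X$. (WDQO) For every object $X$ there is a minimal decidable object $p_X:X\to\Pi(X)$ that uniquely factors arrows to $1+1$. That is, $\Pi(X)$ is decidable, every arrow $X\to 1+1$ factors uniquely through $p_X$, and whenever $p_X=m\circ q$ with $m:D\to\Pi(X)$ monic, $D$ decidable and $q:X\to D$ such that every arrow $X\to 1+1$ factors uniquely through $q$, then $m$ is an isomorphism. Let $T$ be an object that is connected, i.e. $\Pi(T)\cong 1$, let $0:1\to T$ be a point of $T$, and let $A$ be a decidable object. Then evaluation at $0$, $$\mathrm{ev}^0_A:\ A^T\xrightarrow{\ \langle 1,!\rangle\ }A^T\times 1\xrightarrow{\ 1\times 0\ }A^T\times T\xrightarrow{\ \mathrm{ev}\ }A,$$ is an isomorphism. -/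

import Mathlib

open CategoryTheory CategoryTheory.Limits MonoidalCategory CartesianMonoidalCategory

universe v u

namespace DecTopos

section Basic

variable {E : Type u} [Category.{v} E] [CartesianMonoidalCategory E]

/-- An object `A` is decidable if its diagonal `A ⟶ A ⊗ A` is a complemented subobject: there is an
arrow `c : U ⟶ A ⊗ A` such that `A ⊗ A` is the coproduct of `A` and `U`, with injections the
diagonal and `c`. (`⊗` is the cartesian product and `𝟙_ E` is the terminal object.) -/
def IsDecidable (A : E) : Prop :=
  ∃ (U : E) (c : U ⟶ A ⊗ A), Nonempty (IsColimit (BinaryCofan.mk (lift (𝟙 A) (𝟙 A)) c))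

/-- Every arrow `X ⟶ 1 + 1` factors uniquely through `p : X ⟶ P`. Here `1 + 1` is any coproduct of
two copies of the terminal object; in a topos it exists, and it is unique up to isomorphism. -/
def UniquelyFactorsTwo {X P : E} (p : X ⟶ P) : Prop :=
  ∀ two : BinaryCofan (𝟙_ E) (𝟙_ E), IsColimit two →
    ∀ f : X ⟶ two.pt, ∃! g : P ⟶ two.pt, p ≫ g = f

/-- `p : X ⟶ P` exhibits `P` as a minimal decidable object that uniquely factors the arrows
`X ⟶ 1 + 1`: no proper subobject of `P` has the same property. -/
structure IsMinimalDecidable {X P : E} (p : X ⟶ P) : Prop where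
  decidable : IsDecidable P
  factors : UniquelyFactorsTwo p
  minimal : ∀ {D : E} (q : X ⟶ D) (m : D ⟶ P) [Mono m], q ≫ m = p →
    IsDecidable D → UniquelyFactorsTwo q → IsIso m

end Basic

section Postulates

variable (E : Type u) [Category.{v} E] [CartesianMonoidalCategory E]

/-- The Nullstellensatz: every object that is not initial has a point. -/
def NS : Prop :=
  ∀ X : E, IsEmpty (IsInitial X) → Nonempty (𝟙_ E ⟶ X)

/-- The postulate WDQO: for every object `X` there is a minimal decidable object
`p X : X ⟶ Pi X` that uniquely factors the arrows `X ⟶ 1 + 1`. -/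
structure WDQO where
  Pi : E → E
  p : ∀ X : E, X ⟶ Pi X
  isMinimalDecidable : ∀ X : E, IsMinimalDecidable (p X)

end Postulates

variable {E : Type u} [Category.{v} E] [CartesianMonoidalCategory E]

/-- `X` is connected if `Π(X) = 1`. -/
def WDQO.IsConnected (W : WDQO E) (X : E) : Prop :=
  Nonempty (W.Pi X ≅ 𝟙_ E)

/-- Evaluation at the point `t` of `T`, from the exponential `A ^ T` to `A`. -/
def evAt [MonoidalClosed E] {T : E} (t : 𝟙_ E ⟶ T) (A : E) : (ihom T).obj A ⟶ A :=
  lift (toUnit _ ≫ t) (𝟙 _) ≫ (ihom.ev T).app A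

end DecTopos

namespace DecTopos

variable {E : Type u} [Category.{v} E]

section Classifier

variable [HasSubobjectClassifier E]

open HasSubobjectClassifier

/-! Constant functions split evaluation at `0`, so it is enough that evaluation is monic. Let `f, g
: X ⟶ A^T` agree at `0`, and pull the complement `U` of the diagonal of `A` back along the pair of
their transposes `T ⊗ X ⟶ A ⊗ A`. By (NS) this pullback is initial or has a point. If initial, the
transposes agree, since pullbacks of coproduct injections are jointly epic (`hom_ext_of_isColimit`).
A point would lie over the diagonal too, because arrows from `T` to `A` take one value at all points
(`comp_eq_of_isDecidable`); then the topos is degenerate (`hom_eq_of_point_eq`). -/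

/-- Two arrows to the subobject classifier agree if they are true on the same generalized
elements. -/
theorem hom_ext_truth [HasPullbacks E] {B : E} {φ ψ : B ⟶ Ω E}
    (h : ∀ {Y : E} (y : Y ⟶ B), y ≫ φ = Subobject.Classifier.χ₀ _ Y ≫ truth E ↔
      y ≫ ψ = Subobject.Classifier.χ₀ _ Y ≫ truth E) : φ = ψ := by
  have key : ∀ {Y : E} (z : Y ⟶ Ω₀ E), z = Subobject.Classifier.χ₀ _ Y := fun z ↦
    (Subobject.Classifier.isTerminalΩ₀).hom_ext _ _
  have hφ : IsPullback (pullback.fst φ (truth E)) (Subobject.Classifier.χ₀ _ _) φ (truth E) := by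
    rw [← key (pullback.snd φ (truth E))]
    exact IsPullback.of_hasPullback _ _
  have hψ : IsPullback (pullback.fst φ (truth E)) (Subobject.Classifier.χ₀ _ _) ψ (truth E) := by
    refine ⟨⟨(h _).1 hφ.w⟩, ⟨PullbackCone.IsLimit.mk _ (fun s ↦ hφ.lift s.fst s.snd ?_) ?_ ?_ ?_⟩⟩
    · rw [key s.snd]
      refine (h _).2 ?_
      rw [← key s.snd]
      exact s.condition
    · intro s
      simp
    · intro s
      exact (key _).trans (key s.snd).symm
    · intro s l hl _
      rw [← cancel_mono (pullback.fst φ (truth E)), hl]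
      simp
  rw [unique _ _ hφ, unique _ _ hψ]

/-- The generalized elements of a subobject are those on which its characteristic map is true. -/
theorem comp_χ_eq_truth_iff {M B Y : E} (m : M ⟶ B) [Mono m] (y : Y ⟶ B) :
    y ≫ χ m = Subobject.Classifier.χ₀ _ Y ≫ truth E ↔ ∃ a, a ≫ m = y := by
  constructor
  · intro h
    exact ⟨(isPullback_χ m).lift _ _ h, (isPullback_χ m).lift_fst _ _ h⟩
  · rintro ⟨a, rfl⟩
    rw [Category.assoc, HasSubobjectClassifier.comm, ← Category.assoc]
    congr 1
    exact (Subobject.Classifier.isTerminalΩ₀).hom_ext _ _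

end Classifier

theorem exists_desc_of_isColimit {A U X Z : E} {i : A ⟶ X} {j : U ⟶ X}
    (hX : IsColimit (BinaryCofan.mk i j)) (f : A ⟶ Z) (g : U ⟶ Z) :
    ∃ h : X ⟶ Z, i ≫ h = f ∧ j ≫ h = g :=
  ⟨hX.desc (BinaryCofan.mk f g), hX.fac _ ⟨WalkingPair.left⟩, hX.fac _ ⟨WalkingPair.right⟩⟩

theorem inj_hom_ext_of_isColimit {A U X Z : E} {i : A ⟶ X} {j : U ⟶ X}
    (hX : IsColimit (BinaryCofan.mk i j)) {f g : X ⟶ Z} (hi : i ≫ f = i ≫ g)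
    (hj : j ≫ f = j ≫ g) : f = g :=
  BinaryCofan.IsColimit.hom_ext hX hi hj

variable [CartesianMonoidalCategory E] [MonoidalClosed E]

/-- The pullbacks of the injections of a coproduct are jointly epic. -/
theorem hom_ext_of_isColimit [HasFiniteLimits E] [HasSubobjectClassifier E]
    {A U X W Z : E} {i : A ⟶ X} {j : U ⟶ X} (hX : IsColimit (BinaryCofan.mk i j))
    (k : W ⟶ X) {h₁ h₂ : W ⟶ Z}
    (hi : ∀ {Y : E} (w : Y ⟶ W) (a : Y ⟶ A), w ≫ k = a ≫ i → w ≫ h₁ = w ≫ h₂)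
    (hj : ∀ {Y : E} (w : Y ⟶ W) (u : Y ⟶ U), w ≫ k = u ≫ j → w ≫ h₁ = w ≫ h₂) :
    h₁ = h₂ := by
  -- The graph of `k` transposes to `X ⟶ Ω^W`, sending `x` to its fibre. Cutting each fibre down to
  -- where `h₁ = h₂` changes nothing over either summand, hence nothing over `X`.
  let G : W ⟶ W ⊗ X := lift (𝟙 W) k
  have : Mono G := mono_of_mono_fac (show G ≫ fst _ _ = 𝟙 W by simp [G])
  have key : ∀ {B : E} (b : B ⟶ X),
      (∀ {Y : E} (w : Y ⟶ W) (a : Y ⟶ B), w ≫ k = a ≫ b → w ≫ h₁ = w ≫ h₂) →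
      b ≫ MonoidalClosed.curry (HasSubobjectClassifier.χ G) =
        b ≫ MonoidalClosed.curry (HasSubobjectClassifier.χ (equalizer.ι h₁ h₂ ≫ G)) := by
    intro B b hb
    rw [← MonoidalClosed.curry_natural_left, ← MonoidalClosed.curry_natural_left]
    congr 1
    refine hom_ext_truth fun y ↦ ?_
    rw [← Category.assoc, ← Category.assoc, comp_χ_eq_truth_iff, comp_χ_eq_truth_iff]
    constructor
    · rintro ⟨w, hw⟩
      have h : w ≫ k = (y ≫ snd _ _) ≫ b := by simpa [G] using hw =≫ snd _ _
      exact ⟨equalizer.lift w (hb w _ h), by rw [equalizer.lift_ι_assoc, hw]⟩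
    · rintro ⟨w, hw⟩
      exact ⟨w ≫ equalizer.ι h₁ h₂, by rw [Category.assoc, hw]⟩
  have h : HasSubobjectClassifier.χ G =
      HasSubobjectClassifier.χ (equalizer.ι h₁ h₂ ≫ G) :=
    MonoidalClosed.curry_injective (inj_hom_ext_of_isColimit hX (key i hi) (key j hj))
  obtain ⟨w, hw⟩ := (comp_χ_eq_truth_iff (equalizer.ι h₁ h₂ ≫ G) G).1
    (h ▸ (comp_χ_eq_truth_iff G G).2 ⟨𝟙 _, Category.id_comp _⟩)
  have hw' : w ≫ equalizer.ι h₁ h₂ = 𝟙 W := by simpa [G] using hw =≫ fst _ _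
  rw [← Category.id_comp h₁, ← Category.id_comp h₂, ← hw', Category.assoc, Category.assoc,
    equalizer.condition]

/-- If the injections of a coproduct meet in a point, then the category is degenerate. -/
theorem hom_eq_of_point_eq {A U X : E} {i : A ⟶ X} {j : U ⟶ X}
    (hX : IsColimit (BinaryCofan.mk i j)) {a : 𝟙_ E ⟶ A} {b : 𝟙_ E ⟶ U} (hab : a ≫ i = b ≫ j)
    {Y Z : E} (p q : Y ⟶ Z) : p = q := by
  have hpt : ∀ {V : E} (x y : 𝟙_ E ⟶ V), x = y := by
    intro V x y
    obtain ⟨d, h₁, h₂⟩ := exists_desc_of_isColimit hX (toUnit A ≫ x) (toUnit U ≫ y)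
    have h := hab =≫ d
    rw [Category.assoc, Category.assoc, h₁, h₂, ← Category.assoc, ← Category.assoc,
      toUnit_unique (a ≫ toUnit A) (𝟙 _), toUnit_unique (b ≫ toUnit U) (𝟙 _)] at h
    simpa using h
  have h : fst Y (𝟙_ E) ≫ p = fst Y (𝟙_ E) ≫ q :=
    MonoidalClosed.curry_injective (hpt _ _)
  simpa using lift (𝟙 Y) (toUnit Y) ≫= h

/-- Parallel arrows out of an object that maps to an initial object are equal. -/
theorem hom_eq_of_isInitial {I Y Z : E} (hI : IsInitial I) (y : Y ⟶ I) (p q : Y ⟶ Z) : p = q := by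
  have h : fst Y I ≫ p = fst Y I ≫ q := MonoidalClosed.curry_injective (hI.hom_ext _ _)
  simpa using lift (𝟙 Y) y ≫= h

/-- Under the Nullstellensatz, the pullback of a cospan either has a point or is initial, in which case
parallel arrows out of an object over it are equal. -/
theorem NS.exists_point_or_hom_eq [HasFiniteLimits E] (hNS : NS E) {W U X : E} (k : W ⟶ X)
    (j : U ⟶ X) :
    (∃ (w : 𝟙_ E ⟶ W) (u : 𝟙_ E ⟶ U), w ≫ k = u ≫ j) ∨
      ∀ {Y Z : E} (w : Y ⟶ W) (u : Y ⟶ U), w ≫ k = u ≫ j → ∀ p q : Y ⟶ Z, p = q := by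
  by_cases h : IsEmpty (IsInitial (pullback k j))
  · obtain ⟨x⟩ := hNS _ h
    exact Or.inl ⟨x ≫ pullback.fst _ _, x ≫ pullback.snd _ _, by
      rw [Category.assoc, pullback.condition, Category.assoc]⟩
  · obtain ⟨hI⟩ := not_isEmpty_iff.1 h
    exact Or.inr fun w u hwu p q ↦ hom_eq_of_isInitial hI (pullback.lift w u hwu) p q

omit [MonoidalClosed E] in
/-- If both summands of a coproduct `X` have a point, then `1 + 1` exists and `X` maps to it by
collapsing the summands. -/
theorem exists_isColimit_two [HasFiniteLimits E] {A U X : E} {i : A ⟶ X} {j : U ⟶ X}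
    (hX : IsColimit (BinaryCofan.mk i j)) (a : 𝟙_ E ⟶ A) (b : 𝟙_ E ⟶ U) :
    ∃ (S : E) (l r : 𝟙_ E ⟶ S) (_ : IsColimit (BinaryCofan.mk l r)) (d : X ⟶ S),
      i ≫ d = toUnit A ≫ l ∧ j ≫ d = toUnit U ≫ r := by
  -- The idempotent `e` collapses each summand to its chosen point; its splitting, an equalizer, is
  -- `1 + 1`.
  obtain ⟨e, he₁, he₂⟩ := exists_desc_of_isColimit hX (toUnit A ≫ a ≫ i) (toUnit U ≫ b ≫ j)
  have ha : a ≫ i ≫ e = a ≫ i := by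
    rw [he₁, ← Category.assoc, toUnit_unique (a ≫ toUnit A) (𝟙 _), Category.id_comp]
  have hb : b ≫ j ≫ e = b ≫ j := by
    rw [he₂, ← Category.assoc, toUnit_unique (b ≫ toUnit U) (𝟙 _), Category.id_comp]
  have hee : e ≫ e = e := by
    refine inj_hom_ext_of_isColimit hX ?_ ?_
    · rw [reassoc_of% he₁, ha, he₁]
    · rw [reassoc_of% he₂, hb, he₂]
  let s := equalizer.ι e (𝟙 X)
  have hs : s ≫ e = s := by
    simpa only [Category.comp_id] using equalizer.condition e (𝟙 X)
  let d : X ⟶ equalizer e (𝟙 X) := equalizer.lift e (by simpa using hee)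
  have hd : d ≫ s = e := equalizer.lift_ι _ _
  have hsd : s ≫ d = 𝟙 _ := by
    rw [← cancel_mono s, Category.assoc, hd, hs, Category.id_comp]
  have hed : e ≫ d = d := by
    rw [← cancel_mono s, Category.assoc, hd, hee]
  have hid : i ≫ d = toUnit A ≫ a ≫ i ≫ d := by
    conv_lhs => rw [← hed, reassoc_of% he₁]
  have hjd : j ≫ d = toUnit U ≫ b ≫ j ≫ d := by
    conv_lhs => rw [← hed, reassoc_of% he₂]
  choose desc hl hr using fun (Z : E) (x y : 𝟙_ E ⟶ Z) ↦
    exists_desc_of_isColimit hX (toUnit A ≫ x) (toUnit U ≫ y)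
  have hal : ∀ (Z : E) (x y : 𝟙_ E ⟶ Z), (a ≫ i ≫ d) ≫ s ≫ desc Z x y = x := by
    intro Z x y
    rw [Category.assoc, Category.assoc, reassoc_of% hd, reassoc_of% ha, hl, ← Category.assoc,
      toUnit_unique (a ≫ toUnit A) (𝟙 _), Category.id_comp]
  have hbr : ∀ (Z : E) (x y : 𝟙_ E ⟶ Z), (b ≫ j ≫ d) ≫ s ≫ desc Z x y = y := by
    intro Z x y
    rw [Category.assoc, Category.assoc, reassoc_of% hd, reassoc_of% hb, hr, ← Category.assoc,
      toUnit_unique (b ≫ toUnit U) (𝟙 _), Category.id_comp]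
  have huniq : ∀ (Z : E) (x y : 𝟙_ E ⟶ Z) (m : equalizer e (𝟙 X) ⟶ Z),
      (a ≫ i ≫ d) ≫ m = x → (b ≫ j ≫ d) ≫ m = y → m = s ≫ desc Z x y := by
    intro Z x y m h₁ h₂
    have h : d ≫ m = desc Z x y := by
      refine inj_hom_ext_of_isColimit hX ?_ ?_
      · rw [hl, reassoc_of% hid, ← h₁, Category.assoc, Category.assoc]
      · rw [hr, reassoc_of% hjd, ← h₂, Category.assoc, Category.assoc]
    rw [← h, ← Category.assoc, hsd, Category.id_comp]
  exact ⟨_, a ≫ i ≫ d, b ≫ j ≫ d, BinaryCofan.isColimitMk (fun t ↦ s ≫ desc t.pt t.inl t.inr)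
    (fun t ↦ hal _ _ _) (fun t ↦ hbr _ _ _) (fun t ↦ huniq _ _ _), d, hid, hjd⟩

omit [MonoidalClosed E] in
/-- Arrows from a connected object to `1 + 1` take the same value at all points. -/
theorem WDQO.IsConnected.comp_eq (W : WDQO E) {T : E} (hT : W.IsConnected T)
    {S : E} {l r : 𝟙_ E ⟶ S} (hS : IsColimit (BinaryCofan.mk l r)) (f : T ⟶ S)
    (s t : 𝟙_ E ⟶ T) : s ≫ f = t ≫ f := by
  obtain ⟨e⟩ := hT
  obtain ⟨g, hg⟩ : ∃ g : W.Pi T ⟶ S, W.p T ≫ g = f :=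
    ((W.isMinimalDecidable T).factors _ hS f).exists
  have h : s ≫ W.p T = t ≫ W.p T := by
    rw [← cancel_mono e.hom]
    exact toUnit_unique _ _
  rw [← hg, ← Category.assoc, ← Category.assoc, h]

variable [HasFiniteLimits E] [HasSubobjectClassifier E]

/-- Arrows from a connected object to a decidable object take the same value at all points. -/
theorem WDQO.IsConnected.comp_eq_of_isDecidable (hNS : NS E) (W : WDQO E) {T : E}
    (hT : W.IsConnected T) {A : E} (hA : IsDecidable A) (f : T ⟶ A) (s t : 𝟙_ E ⟶ T) :
    s ≫ f = t ≫ f := by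
  obtain ⟨U, c, ⟨hc⟩⟩ := hA
  rcases hNS.exists_point_or_hom_eq (lift (s ≫ f) (t ≫ f)) c with ⟨w, u, hwu⟩ | h
  · obtain ⟨S, l, r, hS, d, hl, hr⟩ := exists_isColimit_two hc (s ≫ f) u
    -- The arrow `x ↦ (f x, f t)` sends `s` into `U` and `t` into the diagonal, so `key` forces `l =
    -- r`.
    have key := WDQO.IsConnected.comp_eq W hT hS (lift f (toUnit T ≫ t ≫ f) ≫ d) s t
    have hs : s ≫ lift f (toUnit T ≫ t ≫ f) = u ≫ c := by
      rw [← hwu, toUnit_unique w (𝟙 _), Category.id_comp]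
      ext <;> simp
    have ht : t ≫ lift f (toUnit T ≫ t ≫ f) = (t ≫ f) ≫ lift (𝟙 A) (𝟙 A) := by
      ext <;> simp
    rw [reassoc_of% hs, reassoc_of% ht, hl, hr] at key
    refine hom_eq_of_point_eq hS (a := 𝟙 _) (b := 𝟙 _) ?_ _ _
    simpa using key.symm
  · refine hom_ext_of_isColimit hc (lift (s ≫ f) (t ≫ f)) ?_ fun w u hwu ↦ h w u hwu _ _
    intro Y w a hwa
    have h₁ := hwa =≫ fst _ _
    have h₂ := hwa =≫ snd _ _
    simp only [Category.assoc, lift_fst, lift_snd, Category.comp_id] at h₁ h₂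
    rw [h₁, h₂]

omit [HasFiniteLimits E] [HasSubobjectClassifier E] in
theorem comp_evAt {X T A : E} (t : 𝟙_ E ⟶ T) (f : X ⟶ (ihom T).obj A) :
    f ≫ evAt t A = lift (toUnit X ≫ t) (𝟙 X) ≫ MonoidalClosed.uncurry f := by
  rw [evAt, MonoidalClosed.uncurry_eq, ← Category.assoc, ← Category.assoc]
  congr 1
  ext <;> simp

/-- Evaluation at a point of a connected object is monic on a decidable object. -/
theorem WDQO.IsConnected.mono_evAt (hNS : NS E) (W : WDQO E) {T : E} (hT : W.IsConnected T)
    (t : 𝟙_ E ⟶ T) {A : E} (hA : IsDecidable A) : Mono (evAt t A) := by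
  refine ⟨fun {X} f g hfg ↦ MonoidalClosed.uncurry_injective ?_⟩
  have value : ∀ (h : X ⟶ (ihom T).obj A) (w : 𝟙_ E ⟶ T ⊗ X),
      w ≫ MonoidalClosed.uncurry h = (w ≫ snd _ _) ≫ h ≫ evAt t A := by
    intro h w
    -- Restrict to the slice of `T ⊗ X` through `w` and move its `T`-coordinate to `t`.
    have key := WDQO.IsConnected.comp_eq_of_isDecidable hNS W hT hA
      (lift (𝟙 T) (toUnit T ≫ w ≫ snd _ _) ≫ MonoidalClosed.uncurry h) (w ≫ fst _ _) t
    have h₁ : (w ≫ fst _ _) ≫ lift (𝟙 T) (toUnit T ≫ w ≫ snd _ _) = w := by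
      ext <;> simp
    have h₂ : t ≫ lift (𝟙 T) (toUnit T ≫ w ≫ snd _ _) =
        (w ≫ snd _ _) ≫ lift (toUnit X ≫ t) (𝟙 X) := by
      ext <;> simp
    rw [← Category.assoc, h₁, reassoc_of% h₂] at key
    rw [key, comp_evAt, Category.assoc]
  obtain ⟨U, c, ⟨hc⟩⟩ := hA
  refine hom_ext_of_isColimit hc
    (lift (MonoidalClosed.uncurry f) (MonoidalClosed.uncurry g)) ?_ ?_
  · intro Y w a hwa
    have h₁ := hwa =≫ fst _ _
    have h₂ := hwa =≫ snd _ _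
    simp only [Category.assoc, lift_fst, lift_snd, Category.comp_id] at h₁ h₂
    rw [h₁, h₂]
  · intro Y w u hwu
    rcases hNS.exists_point_or_hom_eq
      (lift (MonoidalClosed.uncurry f) (MonoidalClosed.uncurry g)) c with ⟨w', u', h'⟩ | h
    -- By `value` and `hfg` both transposes agree at `w'`, so the point `u'` of `U` meets the
    -- diagonal.
    · refine hom_eq_of_point_eq hc (a := w' ≫ MonoidalClosed.uncurry f) (b := u') ?_ _ _
      rw [← h']
      ext
      · simp
      · simp [value f w', value g w', hfg]
    · exact h w u hwu _ _

omit [HasFiniteLimits E] [HasSubobjectClassifier E] in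
/-- Evaluation at a point is split by the constant functions. -/
theorem curry_snd_comp_evAt {T : E} (t : 𝟙_ E ⟶ T) (A : E) :
    MonoidalClosed.curry (snd T A) ≫ evAt t A = 𝟙 A := by
  rw [comp_evAt, MonoidalClosed.uncurry_curry, lift_snd]

end DecTopos

theorem theoremT {E : Type u} [Category.{v} E] [CartesianMonoidalCategory E] [MonoidalClosed E]
    [HasFiniteLimits E] [HasSubobjectClassifier E]
    (hNS : DecTopos.NS E) (W : DecTopos.WDQO E)
    (T : E) (hT : W.IsConnected T) (zero : 𝟙_ E ⟶ T)
    (A : E) (hA : DecTopos.IsDecidable A) :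
    IsIso (DecTopos.evAt zero A) := by
  have := DecTopos.WDQO.IsConnected.mono_evAt hNS W hT zero hA
  refine ⟨MonoidalClosed.curry (snd T A), ?_, DecTopos.curry_snd_comp_evAt zero A⟩
  rw [← cancel_mono (DecTopos.evAt zero A), Category.assoc, DecTopos.curry_snd_comp_evAt,
    Category.comp_id, Category.id_comp]
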